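/- Let $E$ be a finite set and $\mathcal{L}\subseteq 2^E$ a family of subsets. For $e\in E$ the toggle $t_e:\mathcal{L}\to\mathcal{L}$ is defined by $t_e(X)=X\cup\{e\}$ if $e\notin X$ and $X\cup\{e\}\in\mathcal{L}$; $t_e(X)=X\setminus\{e\}$ if $e\in X$ and $X\setminus\{e\}\in\mathcal{L}$; and $t_e(X)=X$ otherwise. The toggle group $T(\mathcal{L})$ is the subgroup of the symmetric group $\mathfrak{S}_{\mathcal{L}}$ generated by $\{t_e \mid e\in E\}$, and $\mathcal{L}$ is called toggle-alternating if $T(\mathcal{L})$ contains the alternating group $A_{\mathcal{L}}$. Let $P$ be a finite poset and let $\mathcal{A}(P)\subseteq 2^P$ be the set of antichains of $P$. (1) If $P$ is the disjoint union of two posets $P=P_1+P_2$ (elements of $P_1$ being incomparable to elements of $P_2$), then $T(\mathcal{A}(P)) = T(\mathcal{A}(P_1))\times T(\mathcal{A}(P_2))$; that is, $A\mapsto (A\cap P_1,A\cap P_2)$ is a bijection $\mathcal{A}(P)\to\mathcal{A}(P_1)\times\mathcal{A}(P_2)$, and there is a group isomorphism $T(\mathcal{A}(P))\to T(\mathcal{A}(P_1))\times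 T(\mathcal{A}(P_2))$, $g\mapsto (g_1,g_2)$, such that $g(A)\cap P_i=g_i(A\cap P_i)$ for all $g\in T(\mathcal{A}(P))$, all $A\in\mathcal{A}(P)$ and $i=1,2$. (2) If $P$ is not the disjoint union of two nonempty posets, then $\mathcal{A}(P)$ is toggle-alternating. -/

import Mathlib

open Classical in
/-- The toggle `t_e : L → L` of a family `L` of subsets of `E`. -/
noncomputable def toggleFun {E : Type*} (L : Set (Set E)) (e : E) (X : L) : L :=
  if h : e ∉ X.1 ∧ X.1 ∪ {e} ∈ L then ⟨X.1 ∪ {e}, h.2⟩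
  else if h : e ∈ X.1 ∧ X.1 \ {e} ∈ L then ⟨X.1 \ {e}, h.2⟩
  else X

theorem toggleFun_involutive {E : Type*} (L : Set (Set E)) (e : E) :
    Function.Involutive (toggleFun L e) := by
  rintro ⟨X, hX⟩
  by_cases he : e ∈ X
  · have h1 : X \ {e} ∪ {e} = X := by simp [he]
    by_cases h : X \ {e} ∈ L
    · simp [toggleFun, he, h, hX]
    · simp [toggleFun, he, h]
  · have h1 : (X ∪ {e}) \ {e} = X := by simp [he]
    by_cases h : X ∪ {e} ∈ L
    · have h2 : toggleFun L e ⟨X, hX⟩ = ⟨X ∪ {e}, h⟩ := by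
        simp only [toggleFun]; rw [dif_pos ⟨he, h⟩]
      rw [h2]
      simp only [toggleFun]
      rw [dif_neg (by simp), dif_pos ⟨by simp, by rw [h1]; exact hX⟩]
      exact Subtype.ext h1
    · have h2 : toggleFun L e ⟨X, hX⟩ = ⟨X, hX⟩ := by
        simp only [toggleFun]; rw [dif_neg (fun c => h c.2), dif_neg (fun c => he c.1)]
      rw [h2, h2]

/-- The toggle `t_e` as a permutation of `L`. -/
noncomputable def toggle {E : Type*} (L : Set (Set E)) (e : E) : Equiv.Perm L :=
  (toggleFun_involutive L e).toPerm

/-- The (generalized) toggle group `T(L)`: the subgroup of the symmetric group on `L` generated by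
the toggles. -/
def toggleGroup {E : Type*} (L : Set (Set E)) : Subgroup (Equiv.Perm L) :=
  Subgroup.closure (Set.range (toggle L))

open Classical in
/-- `L` is toggle-alternating if `T(L)` contains the alternating group on `L`. -/
def ToggleAlternating {E : Type*} [Finite E] (L : Set (Set E)) : Prop :=
  letI : Fintype L := Fintype.ofFinite L
  alternatingGroup L ≤ toggleGroup L

/-- The family of antichains of a poset. -/
def antichains (P : Type*) [PartialOrder P] : Set (Set P) :=
  {A | IsAntichain (· ≤ ·) A}

/-- `P` is the disjoint union (`P₁ ⊕ P₂` carries the disjoint-union order, in which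
elements of different summands are incomparable) of two nonempty posets. -/
def IsDisjointUnionOfPosets.{u} (P : Type u) [PartialOrder P] : Prop :=
  ∃ (P₁ P₂ : Type u) (_ : PartialOrder P₁) (_ : PartialOrder P₂),
    Nonempty P₁ ∧ Nonempty P₂ ∧ Nonempty (P₁ ⊕ P₂ ≃o P)

/-! Antichains are the independent sets of the comparability graph, and a subset with no edge to its
complement splits off as a disjoint summand. Part (2) thus concerns graphs in which every proper
nonempty vertex set has an outgoing edge. There one grows a vertex set `U`, starting from an edge,
while its independent subsets stay toggle-alternating.

The growth step is `toggleAlternating_insert`, adding `v` adjacent to `u ∈ U`. An even permutation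
of the old family lifts to the new toggle group, but with no control on sets containing `v`. The
toggle at `u` fixes all those sets, so a commutator with it is trivial on them. This yields one
genuine 3-cycle, and conjugating by lifts yields all 3-cycles on the old family. The toggle at `v`
carries each remaining set into the old family, and `alternatingGroup_le_of_cover` concludes.

For part (1), a toggle at an element of one summand acts on that factor alone, so the product
isomorphism can be checked on generators. -/

open Equiv Equiv.Perm

/-! ### Generating the alternating group by 3-cycles. -/

section ThreeCycles

variable {α : Type*} [Fintype α] [DecidableEq α]

/-- A permutation group containing all 3-cycles through two fixed points contains the alternating
group. -/
theorem alternatingGroup_le_of_swap_mul_swap_mem (G : Subgroup (Perm α)) {x y : α} (hxy : x ≠ y)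
    (h : ∀ w, w ≠ x → w ≠ y → swap x y * swap x w ∈ G) : alternatingGroup α ≤ G := by
  set s := swap x y with hs
  have hss : s * s = 1 := swap_mul_self x y
  have hx : ∀ w, w ≠ x → s * swap x w ∈ G := by
    intro w hwx
    by_cases hwy : w = y
    · rw [hwy, hss]; exact G.one_mem
    · exact h w hwx hwy
  have hinv : ∀ a b : α, (s * swap a b)⁻¹ = swap a b * s := by simp [hs]
  have hx' : ∀ w, w ≠ x → swap x w * s ∈ G := fun w hw => hinv x w ▸ G.inv_mem (hx w hw)
  have hswap : ∀ a b, a ≠ b → s * swap a b ∈ G := by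
    intro a b hab
    by_cases hax : a = x
    · subst hax; exact hx b hab.symm
    by_cases hbx : b = x
    · subst hbx; rw [swap_comm]; exact hx a hab
    have e : swap a b = swap x a * swap x b * swap x a := by
      have := swap_apply_apply (swap x a) x b
      rwa [swap_apply_left, swap_apply_of_ne_of_ne hbx hab.symm, swap_inv] at this
    have : s * swap a b = (s * swap x a) * (swap x b * s) * (s * swap x a) := by
      rw [e]
      calc _ = s * swap x a * swap x b * 1 * swap x a := by group
        _ = _ := by rw [← hss]; group
    rw [this]
    exact G.mul_mem (G.mul_mem (hx a hax) (hx' b hbx)) (hx a hax)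
  have hswap' : ∀ a b, a ≠ b → swap a b * s ∈ G := fun a b hab =>
    hinv a b ▸ G.inv_mem (hswap a b hab)
  -- `G` is not known to be normalized by `s`, so the induction carries two memberships for each
  -- parity. Inserting `s * s = 1` after a new transposition exchanges the two cases.
  have key : ∀ σ : Perm α, (sign σ = 1 ∧ σ ∈ G ∧ s * σ * s ∈ G) ∨
      (sign σ = -1 ∧ s * σ ∈ G ∧ σ * s ∈ G) := by
    intro σ
    induction σ using swap_induction_on with
    | one => exact Or.inl ⟨sign_one, G.one_mem, by rw [mul_one, hss]; exact G.one_mem⟩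
    | swap_mul f a b hab ih =>
      rcases ih with ⟨h0, h1, h2⟩ | ⟨h0, h1, h2⟩
      · refine Or.inr ⟨by simp [sign_swap hab, h0], ?_, ?_⟩
        · rw [← mul_assoc]; exact G.mul_mem (hswap a b hab) h1
        · have : swap a b * f * s = (swap a b * s) * (s * f * s) := by
            calc _ = swap a b * 1 * f * s := by group
              _ = _ := by rw [← hss]; group
          rw [this]; exact G.mul_mem (hswap' a b hab) h2
      · refine Or.inl ⟨by simp [sign_swap hab, h0], ?_, ?_⟩
        · have : swap a b * f = (swap a b * s) * (s * f) := by
            calc _ = swap a b * 1 * f := by group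
              _ = _ := by rw [← hss]; group
          rw [this]; exact G.mul_mem (hswap' a b hab) h1
        · have : s * (swap a b * f) * s = (s * swap a b) * (f * s) := by group
          rw [this]; exact G.mul_mem (hswap a b hab) h2
  intro σ hσ
  rw [mem_alternatingGroup] at hσ
  rcases key σ with ⟨-, h1, -⟩ | ⟨h0, -⟩
  · exact h1
  · rw [hσ] at h0; exact absurd h0 (by decide)

theorem swap_mul_swap_mem_alternatingGroup {a b c d : α} (hab : a ≠ b) (hcd : c ≠ d) :
    swap a b * swap c d ∈ alternatingGroup α := by
  simp [mem_alternatingGroup, sign_swap hab, sign_swap hcd]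

/-- A permutation group normalized by the alternating group and containing a 3-cycle contains the
alternating group. -/
theorem alternatingGroup_le_of_conj_mem (K : Subgroup (Perm α))
    (hK : ∀ a ∈ alternatingGroup α, ∀ k ∈ K, a * k * a⁻¹ ∈ K) {x y z : α}
    (hxy : x ≠ y) (hxz : x ≠ z) (hyz : y ≠ z) (h : swap x y * swap x z ∈ K) :
    alternatingGroup α ≤ K := by
  refine alternatingGroup_le_of_swap_mul_swap_mem K hxy fun w hwx hwy => ?_
  by_cases hwz : w = z
  · rwa [hwz]
  -- The second transposition replaces `z` by `w`; the first makes `a` even, at the cost of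
  -- inverting the 3-cycle.
  set a := swap x y * swap z w with ha
  have hconj := hK a (swap_mul_swap_mem_alternatingGroup hxy (Ne.symm hwz)) _ h
  have hax : a x = y := by
    rw [ha, mul_apply, swap_apply_of_ne_of_ne hxz hwx.symm, swap_apply_left]
  have hay : a y = x := by
    rw [ha, mul_apply, swap_apply_of_ne_of_ne hyz hwy.symm, swap_apply_right]
  have haz : a z = w := by
    rw [ha, mul_apply, swap_apply_left, swap_apply_of_ne_of_ne hwx hwy]
  have e : a * (swap x y * swap x z) * a⁻¹ = (swap x y * swap x w)⁻¹ := by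
    calc _ = (a * swap x y * a⁻¹) * (a * swap x z * a⁻¹) := by group
      _ = swap y x * swap y w := by rw [← swap_apply_apply, ← swap_apply_apply, hax, hay, haz]
      _ = swap x w * swap x y := by
        have := mul_swap_eq_swap_mul (swap y x) y w
        rw [swap_apply_left, swap_apply_of_ne_of_ne hwy hwx] at this
        rw [this, swap_comm y x]
      _ = _ := by simp
  rw [e] at hconj
  exact K.inv_mem_iff.1 hconj

/-- If a group contains all 3-cycles on `S`, and an element `τ` such that `S` and its preimage under
`τ` cover everything, and `S` meets this preimage, then it contains the alternating group. -/
theorem alternatingGroup_le_of_cover (G : Subgroup (Perm α)) (S : Set α)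
    (hS : ∀ a ∈ S, ∀ b ∈ S, ∀ c ∈ S, a ≠ b → a ≠ c → b ≠ c → swap a b * swap a c ∈ G)
    {τ : Perm α} (hτ : τ ∈ G) (hcover : ∀ w, w ∈ S ∨ τ w ∈ S)
    {x y z : α} (hx : x ∈ S) (hτx : τ x ∈ S) (hy : y ∈ S) (hz : z ∈ S)
    (hxy : x ≠ y) (hxz : x ≠ z) (hyz : y ≠ z) : alternatingGroup α ≤ G := by
  have hS' : ∀ a b c, τ a ∈ S → τ b ∈ S → τ c ∈ S → a ≠ b → a ≠ c → b ≠ c →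
      swap a b * swap a c ∈ G := by
    intro a b c ha hb hc hab hac hbc
    have := G.mul_mem (G.mul_mem (G.inv_mem hτ) (hS _ ha _ hb _ hc (τ.injective.ne hab)
      (τ.injective.ne hac) (τ.injective.ne hbc))) hτ
    rw [swap_apply_apply, swap_apply_apply] at this
    convert this using 1
    group
  by_cases hd : ∃ d ∈ S, τ d ∈ S ∧ d ≠ x
  -- With two common points `x`, `d`, every 3-cycle through them lies within `S` or within its
  -- preimage.
  · obtain ⟨d, hd, hτd, hdx⟩ := hd
    refine alternatingGroup_le_of_swap_mul_swap_mem G hdx.symm fun w hwx hwd => ?_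
    rcases hcover w with hw | hw
    · exact hS _ hx _ hd _ hw hdx.symm hwx.symm hwd.symm
    · exact hS' _ _ _ hτx hτd hw hdx.symm hwx.symm hwd.symm
  · push Not at hd
    refine alternatingGroup_le_of_swap_mul_swap_mem G hyz fun w hwy hwz => ?_
    by_cases hw : w ∈ S
    · exact hS _ hy _ hz _ hw hyz hwy.symm hwz.symm
    have hτw := (hcover w).resolve_left hw
    have hwx : w ≠ x := fun h => hw (h ▸ hx)
    -- a third point of the preimage of `S`, outside `S`
    obtain ⟨d, hτd, hdx, hdw⟩ : ∃ d, τ d ∈ S ∧ d ≠ x ∧ d ≠ w := by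
      by_contra! hcon
      have h3 : ∀ p ∈ S, τ.symm p = x ∨ τ.symm p = w := fun p hp => by
        by_cases hp' : τ.symm p = x
        · exact Or.inl hp'
        · exact Or.inr (hcon _ (by simpa using hp) hp')
      have inj := τ.symm.injective
      rcases h3 x hx with h1 | h1 <;> rcases h3 y hy with h2 | h2 <;>
        rcases h3 z hz with h3 | h3 <;>
        first
        | exact hxy (inj (h1.trans h2.symm))
        | exact hxz (inj (h1.trans h3.symm))
        | exact hyz (inj (h2.trans h3.symm))
    have hdS : d ∉ S := fun h => hdx (hd d h hτd)
    -- This 3-cycle in the preimage of `S` meets `S` only in `x`. Conjugation by it moves `x` to `w`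
    -- and keeps `y`, `z`.
    set k := swap x d * swap x w with hk
    have hkG : k ∈ G := hS' _ _ _ hτx hτd hτw hdx.symm hwx.symm hdw
    have hfix : ∀ p ∈ S, p ≠ x → k p = p := fun p hp hpx => by
      rw [hk, mul_apply, swap_apply_of_ne_of_ne hpx (ne_of_mem_of_not_mem hp hw),
        swap_apply_of_ne_of_ne hpx (ne_of_mem_of_not_mem hp hdS)]
    have hkx : k x = w := by
      rw [hk, mul_apply, swap_apply_left, swap_apply_of_ne_of_ne hwx hdw.symm]
    have := G.mul_mem (G.mul_mem hkG (hS _ hy _ hz _ hx hyz hxy.symm hxz.symm)) (G.inv_mem hkG)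
    have e : k * (swap y z * swap y x) * k⁻¹ = swap y z * swap y w := by
      calc _ = (k * swap y z * k⁻¹) * (k * swap y x * k⁻¹) := by group
        _ = _ := by
          rw [← swap_apply_apply, ← swap_apply_apply, hkx, hfix y hy hxy.symm, hfix z hz hxz.symm]
    rwa [e] at this

end ThreeCycles

/-! ### Computing toggles and transporting them along maps. -/

section Toggle

variable {E : Type*} {L : Set (Set E)} {e : E}

theorem toggle_mem_toggleGroup (L : Set (Set E)) (e : E) : toggle L e ∈ toggleGroup L :=
  Subgroup.subset_closure ⟨e, rfl⟩

theorem toggle_apply_of_union_mem {X : L} (he : e ∉ X.1) (h : X.1 ∪ {e} ∈ L) :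
    toggle L e X = ⟨X.1 ∪ {e}, h⟩ := by
  change toggleFun L e X = _
  rw [toggleFun, dif_pos ⟨he, h⟩]

theorem toggle_apply_of_diff_mem {X : L} (he : e ∈ X.1) (h : X.1 \ {e} ∈ L) :
    toggle L e X = ⟨X.1 \ {e}, h⟩ := by
  change toggleFun L e X = _
  rw [toggleFun, dif_neg (fun c => c.1 he), dif_pos ⟨he, h⟩]

theorem toggle_apply_of_union_notMem {X : L} (he : e ∉ X.1) (h : X.1 ∪ {e} ∉ L) :
    toggle L e X = X := by
  change toggleFun L e X = _
  rw [toggleFun, dif_neg (fun c => h c.2), dif_neg (fun c => he c.1)]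

theorem toggle_apply_of_diff_notMem {X : L} (he : e ∈ X.1) (h : X.1 \ {e} ∉ L) :
    toggle L e X = X := by
  change toggleFun L e X = _
  rw [toggleFun, dif_neg (fun c => c.1 he), dif_neg (fun c => h c.2)]

/-- Toggles correspond under a map of families that is compatible with adding and removing
the elements in question. -/
theorem map_toggle {E' : Type*} {M : Set (Set E')} {e' : E'} (f : L → M) (X : L)
    (hmem : e' ∈ (f X).1 ↔ e ∈ X.1)
    (hu : ∀ h : X.1 ∪ {e} ∈ L, (f ⟨_, h⟩).1 = (f X).1 ∪ {e'})
    (hu' : (f X).1 ∪ {e'} ∈ M → X.1 ∪ {e} ∈ L)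
    (hd : ∀ h : X.1 \ {e} ∈ L, (f ⟨_, h⟩).1 = (f X).1 \ {e'})
    (hd' : (f X).1 \ {e'} ∈ M → X.1 \ {e} ∈ L) :
    toggle M e' (f X) = f (toggle L e X) := by
  by_cases he : e ∈ X.1
  · by_cases h : X.1 \ {e} ∈ L
    · rw [toggle_apply_of_diff_mem he h,
        toggle_apply_of_diff_mem (hmem.2 he) (hd h ▸ (f ⟨_, h⟩).2)]
      exact Subtype.ext (hd h).symm
    · rw [toggle_apply_of_diff_notMem he h,
        toggle_apply_of_diff_notMem (hmem.2 he) (fun c => h (hd' c))]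
  · by_cases h : X.1 ∪ {e} ∈ L
    · rw [toggle_apply_of_union_mem he h,
        toggle_apply_of_union_mem (fun c => he (hmem.1 c)) (hu h ▸ (f ⟨_, h⟩).2)]
      exact Subtype.ext (hu h).symm
    · rw [toggle_apply_of_union_notMem he h,
        toggle_apply_of_union_notMem (fun c => he (hmem.1 c)) (fun c => h (hu' c))]

end Toggle

/-! ### Independent subsets of a vertex set, and lifting their toggle group. -/

section Independent

variable {V : Type*} (G : SimpleGraph V)

/-- The independent sets of `G` contained in `U`. -/
def indepSubsets (U : Set V) : Set (Set V) := {X | X ⊆ U ∧ G.IsIndepSet X}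

variable {G} {U : Set V} {v : V}

theorem diff_mem_indepSubsets {X : Set V} (hX : X ∈ indepSubsets G U) (s : Set V) :
    X \ s ∈ indepSubsets G U :=
  ⟨Set.sdiff_subset.trans hX.1, hX.2.mono Set.sdiff_subset⟩

theorem empty_mem_indepSubsets : ∅ ∈ indepSubsets G U :=
  ⟨Set.empty_subset U, Set.pairwise_empty _⟩

theorem singleton_mem_indepSubsets (hv : v ∈ U) : {v} ∈ indepSubsets G U :=
  ⟨Set.singleton_subset_iff.2 hv, Set.pairwise_singleton _ _⟩

theorem toggle_empty (hv : v ∈ U) : toggle (indepSubsets G U) v ⟨∅, empty_mem_indepSubsets⟩ =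
    ⟨{v}, singleton_mem_indepSubsets hv⟩ := by
  have h : (∅ : Set V) ∪ {v} = {v} := Set.empty_union _
  have hmem : (∅ : Set V) ∪ {v} ∈ indepSubsets G U := by
    rw [h]
    exact singleton_mem_indepSubsets hv
  exact (toggle_apply_of_union_mem (Set.notMem_empty v) hmem).trans (Subtype.ext h)

theorem union_notMem_indepSubsets {X : Set V} {u : V} (hu : u ∈ X) (huv : G.Adj u v) :
    X ∪ {v} ∉ indepSubsets G U := fun h =>
  h.2 (Or.inl hu) (Or.inr rfl) huv.ne huv

theorem notMem_of_mem_indepSubsets {X : Set V} {u : V} (hX : X ∈ indepSubsets G U) (hu : u ∈ X)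
    (huv : G.Adj u v) : v ∉ X := fun h => hX.2 hu h huv.ne huv

theorem indepSubsets_subset_insert : indepSubsets G U ⊆ indepSubsets G (insert v U) := fun _ hX =>
  ⟨hX.1.trans (Set.subset_insert v U), hX.2⟩

theorem mem_indepSubsets_of_notMem {X : Set V} (hX : X ∈ indepSubsets G (insert v U))
    (hv : v ∉ X) : X ∈ indepSubsets G U :=
  ⟨(Set.subset_insert_iff_of_notMem hv).1 hX.1, hX.2⟩

/-- Every element of the toggle group of the independent subsets of `U` extends to an element of
the toggle group of the independent subsets of `insert v U`. -/
theorem exists_lift_mem_toggleGroup (hv : v ∉ U) {g : Perm (indepSubsets G U)}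
    (hg : g ∈ toggleGroup (indepSubsets G U)) :
    ∃ h ∈ toggleGroup (indepSubsets G (insert v U)), ∀ X,
      h (Set.inclusion indepSubsets_subset_insert X) =
        Set.inclusion indepSubsets_subset_insert (g X) := by
  induction hg using Subgroup.closure_induction with
  | mem g hg =>
    obtain ⟨e, rfl⟩ := hg
    by_cases hev : e = v
    · subst hev
      refine ⟨1, Subgroup.one_mem _, fun X => ?_⟩
      rw [toggle_apply_of_union_notMem (fun h => hv (X.2.1 h)) (fun h => hv (h.1 (Or.inr rfl)))]
      rfl
    · refine ⟨_, toggle_mem_toggleGroup _ e, fun X => ?_⟩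
      have hvX : v ∉ X.1 := fun h => hv (X.2.1 h)
      refine map_toggle _ X Iff.rfl (fun _ => rfl) (fun h => ?_) (fun _ => rfl)
        (fun _ => diff_mem_indepSubsets X.2 _)
      refine mem_indepSubsets_of_notMem h ?_
      rintro (h | h)
      · exact hvX h
      · exact hev h.symm
  | one => exact ⟨1, Subgroup.one_mem _, fun X => rfl⟩
  | mul g₁ g₂ _ _ ih₁ ih₂ =>
    obtain ⟨h₁, hh₁, e₁⟩ := ih₁
    obtain ⟨h₂, hh₂, e₂⟩ := ih₂
    exact ⟨h₁ * h₂, Subgroup.mul_mem _ hh₁ hh₂, fun X => by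
      rw [mul_apply, e₂, e₁, mul_apply]⟩
  | inv g _ ih =>
    obtain ⟨h, hh, e⟩ := ih
    exact ⟨h⁻¹, Subgroup.inv_mem _ hh, fun X => by
      rw [inv_eq_iff_eq, e, ← mul_apply, mul_inv_cancel, one_apply]⟩

end Independent

/-! ### Extending permutations by the identity along an embedding. -/

section Embedding

variable {α β : Type*} (ι : α ↪ β)

theorem viaEmbedding_swap [DecidableEq α] [DecidableEq β] (a b : α) :
    (swap a b).viaEmbedding ι = swap (ι a) (ι b) := by
  ext w
  by_cases hw : w ∈ Set.range ι
  · obtain ⟨w, rfl⟩ := hw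
    rw [viaEmbedding_apply, ι.injective.swap_apply]
  · rw [viaEmbedding_apply_of_notMem _ _ _ hw, swap_apply_of_ne_of_ne] <;>
    · rintro rfl
      exact hw ⟨_, rfl⟩

variable {ι}

theorem apply_notMem_range {h : Perm β} {g : Perm α} (e : ∀ x, h (ι x) = ι (g x)) {w : β}
    (hw : w ∉ Set.range ι) : h w ∉ Set.range ι := by
  rintro ⟨x, hx⟩
  refine hw ⟨g⁻¹ x, h.injective ?_⟩
  rw [e, ← mul_apply, mul_inv_cancel, one_apply, hx]

theorem inv_lift {h : Perm β} {g : Perm α} (e : ∀ x, h (ι x) = ι (g x)) (x : α) :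
    h⁻¹ (ι x) = ι (g⁻¹ x) := by
  rw [inv_eq_iff_eq, e, ← mul_apply, mul_inv_cancel, one_apply]

/-- The lift `h` may act arbitrarily off the range: it preserves the complement, where the
conjugated permutation is trivial. -/
theorem viaEmbedding_conj {h : Perm β} {g : Perm α} (e : ∀ x, h (ι x) = ι (g x)) (k : Perm α) :
    (g * k * g⁻¹).viaEmbedding ι = h * k.viaEmbedding ι * h⁻¹ := by
  ext w
  by_cases hw : w ∈ Set.range ι
  · obtain ⟨w, rfl⟩ := hw
    simp only [mul_apply, viaEmbedding_apply, inv_lift e, e]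
  · rw [viaEmbedding_apply_of_notMem _ _ _ hw, mul_apply, mul_apply,
      viaEmbedding_apply_of_notMem _ _ _ (apply_notMem_range (inv_lift e) hw), ← mul_apply, mul_inv_cancel, one_apply]

/-- Off the range `t` is the identity, so the unknown action of `h` there cancels against `h⁻¹`. -/
theorem viaEmbedding_commutator {h t : Perm β} {g s : Perm α} (e : ∀ x, h (ι x) = ι (g x))
    (et : ∀ x, t (ι x) = ι (s x)) (ht : ∀ w ∉ Set.range ι, t w = w) :
    (s * g * s⁻¹ * g⁻¹).viaEmbedding ι = t * h * t⁻¹ * h⁻¹ := by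
  have : t = s.viaEmbedding ι := by
    ext w
    by_cases hw : w ∈ Set.range ι
    · obtain ⟨w, rfl⟩ := hw
      rw [et, viaEmbedding_apply]
    · rw [ht w hw, viaEmbedding_apply_of_notMem _ _ _ hw]
  have hom := map_mul (viaEmbeddingHom ι) s (g * s⁻¹ * g⁻¹)
  simp only [viaEmbeddingHom_apply] at hom
  rw [show s * g * s⁻¹ * g⁻¹ = s * (g * s⁻¹ * g⁻¹) by group, hom, viaEmbedding_conj e, this,
    ← viaEmbeddingHom_apply, ← viaEmbeddingHom_apply, map_inv]
  group

end Embedding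

/-! ### Growing the vertex set of a graph. -/

section Independent

variable {V : Type*} [Finite V] {G : SimpleGraph V} {U : Set V} {u v w : V}

theorem toggleAlternating_insert (hU : ToggleAlternating (indepSubsets G U)) (hv : v ∉ U)
    (hu : u ∈ U) (huv : G.Adj u v) (hw : w ∈ U) (huw : G.Adj u w) :
    ToggleAlternating (indepSubsets G (insert v U)) := by
  classical
  let _ : Fintype (indepSubsets G U) := Fintype.ofFinite _
  let _ : Fintype (indepSubsets G (insert v U)) := Fintype.ofFinite _
  replace hU : alternatingGroup (indepSubsets G U) ≤ toggleGroup (indepSubsets G U) := by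
    unfold ToggleAlternating at hU
    convert hU
  let ι : indepSubsets G U ↪ indepSubsets G (insert v U) :=
    ⟨Set.inclusion indepSubsets_subset_insert, Set.inclusion_injective _⟩
  have mem_range : ∀ X : indepSubsets G (insert v U), v ∉ X.1 → X ∈ Set.range ι := fun X hX =>
    ⟨⟨X.1, mem_indepSubsets_of_notMem X.2 hX⟩, rfl⟩
  -- Unlike the lifts in `hlift`, the extension of an element of `K` fixes every set containing `v`.
  let K := (toggleGroup (indepSubsets G (insert v U))).comap (viaEmbeddingHom ι)
  have hlift : ∀ a ∈ alternatingGroup (indepSubsets G U),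
      ∃ h ∈ toggleGroup (indepSubsets G (insert v U)), ∀ X, h (ι X) = ι (a X) :=
    fun a ha => exists_lift_mem_toggleGroup hv (hU ha)
  let x : indepSubsets G U := ⟨∅, empty_mem_indepSubsets⟩
  let y : indepSubsets G U := ⟨{u}, singleton_mem_indepSubsets hu⟩
  let z : indepSubsets G U := ⟨{w}, singleton_mem_indepSubsets hw⟩
  have hxy : x ≠ y := fun h => Set.singleton_ne_empty u (congrArg Subtype.val h).symm
  have hxz : x ≠ z := fun h => Set.singleton_ne_empty w (congrArg Subtype.val h).symm
  have hyz : y ≠ z := fun h => huw.ne (Set.singleton_injective (congrArg Subtype.val h))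
  let t := toggle (indepSubsets G U) u
  have htx : t x = y := toggle_empty hu
  have hty : t y = x := by
    rw [← htx]; exact toggleFun_involutive _ u x
  have htz : t z = z :=
    toggle_apply_of_union_notMem (X := z) (fun h => huw.ne h)
      (union_notMem_indepSubsets (u := w) rfl huw.symm)
  have hK3 : swap x y * swap x z ∈ K := by
    obtain ⟨h, hh, e⟩ := hlift (swap x y * swap x z) (swap_mul_swap_mem_alternatingGroup hxy hxz)
    have et : ∀ X, toggle (indepSubsets G (insert v U)) u (ι X) = ι (t X) := fun X => by
      refine map_toggle _ X Iff.rfl (fun _ => rfl) (fun h => ?_) (fun _ => rfl)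
        (fun _ => diff_mem_indepSubsets X.2 _)
      exact mem_indepSubsets_of_notMem h (notMem_of_mem_indepSubsets h (Or.inr rfl) huv)
    have ht : ∀ X ∉ Set.range ι, toggle (indepSubsets G (insert v U)) u X = X := fun X hX => by
      have hvX : v ∈ X.1 := by_contra fun h => hX (mem_range X h)
      exact toggle_apply_of_union_notMem (notMem_of_mem_indepSubsets X.2 hvX huv.symm)
        (union_notMem_indepSubsets hvX huv.symm)
    -- Conjugation by `t` swaps `x` and `y` and fixes `z`, so it inverts the 3-cycle `c`; the
    -- commutator is `c⁻² = c`.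
    have hc : swap x y * swap x z = t * (swap x y * swap x z) * t⁻¹ * (swap x y * swap x z)⁻¹ := by
      have h1 : t * (swap x y * swap x z) * t⁻¹ = swap x z * swap x y := by
        calc _ = (t * swap x y * t⁻¹) * (t * swap x z * t⁻¹) := by group
          _ = swap y x * swap y z := by
            rw [← swap_apply_apply, ← swap_apply_apply, htx, hty, htz]
          _ = _ := by
            have := mul_swap_eq_swap_mul (swap y x) y z
            rw [swap_apply_left, swap_apply_of_ne_of_ne hyz.symm hxz.symm] at this
            rw [this, swap_comm y x]
      have h2 : (swap x z * swap x y) * (swap x z * swap x y) = swap x y * swap x z := by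
        have h3 := swap_apply_apply (swap x z) x y
        have h4 := mul_swap_eq_swap_mul (swap x y) x z
        rw [swap_apply_left, swap_apply_of_ne_of_ne hxy.symm hyz, swap_inv] at h3
        rw [swap_apply_left, swap_apply_of_ne_of_ne hxz.symm hyz.symm, swap_comm y z, h3] at h4
        rw [h4]
        group
      rw [h1, mul_inv_rev, swap_inv, swap_inv, h2]
    rw [hc]
    rw [Subgroup.mem_comap, viaEmbeddingHom_apply, viaEmbedding_commutator e et ht]
    have htm := toggle_mem_toggleGroup (indepSubsets G (insert v U)) u
    exact mul_mem (mul_mem (mul_mem htm hh) (inv_mem htm)) (inv_mem hh)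
  have hK : alternatingGroup (indepSubsets G U) ≤ K := by
    refine alternatingGroup_le_of_conj_mem K (fun a ha k hk => ?_) hxy hxz hyz hK3
    obtain ⟨h, hh, e⟩ := hlift a ha
    rw [Subgroup.mem_comap, viaEmbeddingHom_apply, viaEmbedding_conj e]
    exact mul_mem (mul_mem hh hk) (inv_mem hh)
  -- The set `{u}` lies in the old family and is fixed by the toggle at `v`: it is the common point
  -- needed for the covering argument.
  have hfix : toggle (indepSubsets G (insert v U)) v (ι y) = ι y :=
    toggle_apply_of_union_notMem (fun h => huv.ne (Set.mem_singleton_iff.1 h).symm)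
      (union_notMem_indepSubsets (u := u) rfl huv)
  unfold ToggleAlternating
  refine alternatingGroup_le_of_cover _ (Set.range ι) ?_ (toggle_mem_toggleGroup _ v) ?_
    (x := ι y) (y := ι x) (z := ι z) ⟨_, rfl⟩ ⟨y, hfix.symm⟩ ⟨_, rfl⟩ ⟨_, rfl⟩
    (ι.injective.ne hxy.symm) (ι.injective.ne hyz) (ι.injective.ne hxz)
  · rintro _ ⟨a, rfl⟩ _ ⟨b, rfl⟩ _ ⟨c, rfl⟩ hab hac -
    have := hK (swap_mul_swap_mem_alternatingGroup
      (fun h => hab (congrArg ι h)) (fun h => hac (congrArg ι h)) : swap a b * swap a c ∈ _)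
    rw [Subgroup.mem_comap, map_mul, viaEmbeddingHom_apply, viaEmbeddingHom_apply, viaEmbedding_swap,
      viaEmbedding_swap] at this
    convert this
  · intro X
    by_cases hX : v ∈ X.1
    · right
      rw [toggle_apply_of_diff_mem hX (diff_mem_indepSubsets X.2 _)]
      exact mem_range _ fun h => h.2 rfl
    · exact Or.inl (mem_range X hX)

/-- The only independent sets are `∅`, `{u}`, `{v}`. The two toggles are transpositions sharing `∅`,
and their product is a 3-cycle. -/
theorem toggleAlternating_pair (huv : G.Adj u v) :
    ToggleAlternating (indepSubsets G {u, v}) := by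
  classical
  let _ : Fintype (indepSubsets G {u, v}) := Fintype.ofFinite _
  let x : indepSubsets G {u, v} := ⟨∅, empty_mem_indepSubsets⟩
  let y : indepSubsets G {u, v} := ⟨{u}, singleton_mem_indepSubsets (Or.inl rfl)⟩
  let z : indepSubsets G {u, v} := ⟨{v}, singleton_mem_indepSubsets (Or.inr rfl)⟩
  have hxy : x ≠ y := fun h => Set.singleton_ne_empty u (congrArg Subtype.val h).symm
  have hxz : x ≠ z := fun h => Set.singleton_ne_empty v (congrArg Subtype.val h).symm
  have hyz : y ≠ z := fun h => huv.ne (Set.singleton_injective (congrArg Subtype.val h))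
  have hcases : ∀ X : indepSubsets G {u, v}, X = x ∨ X = y ∨ X = z := by
    rintro ⟨X, hX⟩
    rcases Set.subset_pair_iff_eq.1 hX.1 with rfl | rfl | rfl | rfl
    · exact Or.inl rfl
    · exact Or.inr (Or.inl rfl)
    · exact Or.inr (Or.inr rfl)
    · exact absurd huv (hX.2 (Or.inl rfl) (Or.inr rfl) huv.ne)
  have hu : toggle (indepSubsets G {u, v}) u = swap x y := by
    have hx : toggle (indepSubsets G {u, v}) u x = y := toggle_empty (Set.mem_insert u {v})
    have hy : toggle (indepSubsets G {u, v}) u y = x := hx ▸ toggleFun_involutive _ u x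
    have hz : toggle (indepSubsets G {u, v}) u z = z :=
      toggle_apply_of_union_notMem (X := z) (fun h => huv.ne h)
        (union_notMem_indepSubsets (u := v) rfl huv.symm)
    refine Equiv.ext fun X => ?_
    rcases hcases X with rfl | rfl | rfl
    · rw [hx, swap_apply_left]
    · rw [hy, swap_apply_right]
    · rw [hz, swap_apply_of_ne_of_ne hxz.symm hyz.symm]
  have hv : toggle (indepSubsets G {u, v}) v = swap x z := by
    have hx : toggle (indepSubsets G {u, v}) v x = z := toggle_empty (Set.mem_insert_of_mem u (Set.mem_singleton v))
    have hz : toggle (indepSubsets G {u, v}) v z = x := hx ▸ toggleFun_involutive _ v x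
    have hy : toggle (indepSubsets G {u, v}) v y = y :=
      toggle_apply_of_union_notMem (X := y) (fun h => huv.ne h.symm)
        (union_notMem_indepSubsets (u := u) rfl huv)
    refine Equiv.ext fun X => ?_
    rcases hcases X with rfl | rfl | rfl
    · rw [hx, swap_apply_left]
    · rw [hy, swap_apply_of_ne_of_ne hxy.symm hyz]
    · rw [hz, swap_apply_right]
  unfold ToggleAlternating
  refine alternatingGroup_le_of_swap_mul_swap_mem _ hxy fun w hwx hwy => ?_
  obtain rfl : w = z := ((hcases w).resolve_left hwx).resolve_left hwy
  have := mul_mem (toggle_mem_toggleGroup (indepSubsets G {u, v}) u)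
    (toggle_mem_toggleGroup (indepSubsets G {u, v}) v)
  rw [hu, hv] at this
  convert this

theorem toggleAlternating_singleton (u : V) : ToggleAlternating (indepSubsets G {u}) := by
  classical
  let _ : Fintype (indepSubsets G {u}) := Fintype.ofFinite _
  let x : indepSubsets G {u} := ⟨∅, empty_mem_indepSubsets⟩
  let y : indepSubsets G {u} := ⟨{u}, singleton_mem_indepSubsets rfl⟩
  have hxy : x ≠ y := fun h => Set.singleton_ne_empty u (congrArg Subtype.val h).symm
  unfold ToggleAlternating
  refine alternatingGroup_le_of_swap_mul_swap_mem _ hxy fun w hwx hwy => ?_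
  rcases Set.subset_singleton_iff_eq.1 w.2.1 with h | h
  · exact absurd (Subtype.ext h) hwx
  · exact absurd (Subtype.ext h) hwy

/-- If every proper nonempty set of vertices has an edge to its complement, then the independent
sets form a toggle-alternating family. -/
theorem toggleAlternating_indepSubsets_univ
    (hG : ∀ U : Set V, U.Nonempty → U ≠ Set.univ → ∃ u ∈ U, ∃ v ∉ U, G.Adj u v) :
    ToggleAlternating (indepSubsets G Set.univ) := by
  rcases isEmpty_or_nonempty V with hV | ⟨⟨u⟩⟩
  · intro g _
    rw [Subsingleton.elim g 1]
    exact one_mem _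
  by_cases hu : ({u} : Set V) = Set.univ
  · exact hu ▸ toggleAlternating_singleton u
  obtain ⟨u', hu', v, -, huv⟩ := hG {u} ⟨u, rfl⟩ hu
  obtain rfl : u' = u := hu'
  -- The neighbour condition supplies the vertex `w` of `toggleAlternating_insert`. It fails for a
  -- singleton, hence the start from an edge.
  let good : Set (Set V) := {U | U.Nonempty ∧ (∀ a ∈ U, ∃ b ∈ U, G.Adj a b) ∧
    ToggleAlternating (indepSubsets G U)}
  have hpair : {u', v} ∈ good := by
    refine ⟨⟨u', Or.inl rfl⟩, ?_, toggleAlternating_pair huv⟩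
    rintro _ (rfl | rfl)
    · exact ⟨v, Or.inr rfl, huv⟩
    · exact ⟨u', Or.inl rfl, huv.symm⟩
  obtain ⟨U, hU⟩ := (Set.toFinite good).exists_maximal ⟨_, hpair⟩
  obtain ⟨⟨hne, hadj, halt⟩, hmax⟩ := hU
  by_cases hUu : U = Set.univ
  · exact hUu ▸ halt
  obtain ⟨a, ha, b, hb, hab⟩ := hG U hne hUu
  obtain ⟨c, hc, hac⟩ := hadj a ha
  have hgood : insert b U ∈ good := by
    refine ⟨⟨b, Or.inl rfl⟩, ?_, toggleAlternating_insert halt hb ha hab hc hac⟩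
    rintro d (rfl | hd)
    · exact ⟨a, Or.inr ha, hab.symm⟩
    · obtain ⟨d', hd', h⟩ := hadj d hd
      exact ⟨d', Or.inr hd', h⟩
  exact absurd (hmax hgood (Set.subset_insert b U) (Or.inl rfl)) hb

end Independent

/-! ### From graphs to posets. -/

section Poset

variable {P : Type*} [PartialOrder P]

/-- The antichains are the independent sets of the comparability graph. -/
theorem antichains_eq_indepSubsets :
    antichains P = indepSubsets (SimpleGraph.fromRel (· ≤ · : P → P → Prop)) Set.univ := by
  ext A
  refine ⟨fun h => ⟨Set.subset_univ _, fun a ha b hb hab hadj => ?_⟩, fun h a ha b hb hab hle => ?_⟩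
  · rcases hadj.2 with h' | h'
    · exact h ha hb hab h'
    · exact h hb ha hab.symm h'
  · exact h.2 ha hb hab ⟨hab, Or.inl hle⟩

/-- A subset without comparabilities to its complement splits off. -/
noncomputable def sumComplOrderIso (U : Set P) (h : ∀ u ∈ U, ∀ v ∉ U, ¬ u ≤ v ∧ ¬ v ≤ u) :
    U ⊕ (Uᶜ : Set P) ≃o P where
  toEquiv := by
    classical exact Equiv.Set.sumCompl U
  map_rel_iff' := by
    rintro (⟨a, ha⟩ | ⟨a, ha⟩) (⟨b, hb⟩ | ⟨b, hb⟩)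
    · simp
    · simpa using (h a ha b hb).1
    · simpa using (h b hb a ha).2
    · simp

theorem toggleAlternating_antichains [Finite P] (hP : ¬ IsDisjointUnionOfPosets P) :
    ToggleAlternating (antichains P) := by
  rw [antichains_eq_indepSubsets]
  refine toggleAlternating_indepSubsets_univ fun U hU hne => ?_
  by_contra! hcon
  refine hP ⟨U, (Uᶜ : Set P), inferInstance, inferInstance, hU.to_subtype,
    (Set.nonempty_compl.2 hne).to_subtype, ⟨sumComplOrderIso U fun u hu v hv => ?_⟩⟩
  have huv : u ≠ v := fun h => hv (h ▸ hu)
  exact ⟨fun h => hcon u hu v hv ⟨huv, Or.inl h⟩, fun h => hcon u hu v hv ⟨huv, Or.inr h⟩⟩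

end Poset

/-! ### Toggle groups of disjoint unions. -/

section Product

/-- Pairs of permutations of the factors act on a type identified with a product. -/
def prodPermHom {α β γ : Type*} (φ : α ≃ β × γ) : Perm β × Perm γ →* Perm α where
  toFun g := (φ.trans (g.1.prodCongr g.2)).trans φ.symm
  map_one' := by ext a; simp
  map_mul' g h := by ext a; simp [Prod.map]

theorem apply_prodPermHom {α β γ : Type*} (φ : α ≃ β × γ) (g : Perm β × Perm γ) (a : α) :
    φ (prodPermHom φ g a) = (g.1 (φ a).1, g.2 (φ a).2) := by
  simp [prodPermHom, Prod.map]

theorem prodPermHom_injective {α β γ : Type*} [Nonempty β] [Nonempty γ] (φ : α ≃ β × γ) :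
    Function.Injective (prodPermHom φ) := by
  intro g h hgh
  have key : ∀ b c, (g.1 b, g.2 c) = (h.1 b, h.2 c) := fun b c => by
    have h1 := apply_prodPermHom φ g (φ.symm (b, c))
    rw [hgh, apply_prodPermHom] at h1
    simpa using h1.symm
  obtain ⟨b₀⟩ := ‹Nonempty β›
  obtain ⟨c₀⟩ := ‹Nonempty γ›
  exact Prod.ext (Equiv.ext fun b => congrArg Prod.fst (key b c₀))
    (Equiv.ext fun c => congrArg Prod.snd (key b₀ c))

variable {P P₁ P₂ : Type*} [PartialOrder P] [PartialOrder P₁] [PartialOrder P₂]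

instance : Nonempty (antichains P) := ⟨⟨∅, Set.pairwise_empty _⟩⟩

/-- Antichains of a disjoint union are pairs of antichains of the summands. -/
def antichainsSumEquiv (e : P₁ ⊕ P₂ ≃o P) : antichains P ≃ antichains P₁ × antichains P₂ where
  toFun A := (⟨{x | e (Sum.inl x) ∈ A.1}, fun x hx y hy hxy hle =>
      A.2 hx hy (fun h => hxy (Sum.inl_injective (e.injective h)))
        (e.le_iff_le.2 (Sum.inl_le_inl_iff.2 hle))⟩,
    ⟨{y | e (Sum.inr y) ∈ A.1}, fun x hx y hy hxy hle =>
      A.2 hx hy (fun h => hxy (Sum.inr_injective (e.injective h)))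
        (e.le_iff_le.2 (Sum.inr_le_inr_iff.2 hle))⟩)
  invFun B := ⟨{p | Sum.elim (· ∈ B.1.1) (· ∈ B.2.1) (e.symm p)}, fun p hp q hq hpq hle => by
    obtain ⟨p, rfl⟩ := e.surjective p
    obtain ⟨q, rfl⟩ := e.surjective q
    rw [e.le_iff_le] at hle
    simp only [Set.mem_ofPred_eq, OrderIso.symm_apply_apply] at hp hq
    rcases p with p | p <;> rcases q with q | q
    · exact B.1.2 hp hq (fun h => hpq (by rw [h])) (Sum.inl_le_inl_iff.1 hle)
    · exact Sum.not_inl_le_inr hle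
    · exact Sum.not_inr_le_inl hle
    · exact B.2.2 hp hq (fun h => hpq (by rw [h])) (Sum.inr_le_inr_iff.1 hle)⟩
  left_inv A := by
    refine Subtype.ext (Set.ext fun p => ?_)
    obtain ⟨p | p, rfl⟩ := e.surjective p <;> simp
  right_inv B := by
    refine Prod.ext (Subtype.ext (Set.ext fun p => ?_)) (Subtype.ext (Set.ext fun p => ?_)) <;> simp

theorem union_mem_antichains_iff {A : Set P} (hA : A ∈ antichains P) {p : P} :
    A ∪ {p} ∈ antichains P ↔ ∀ a ∈ A, a ≠ p → ¬ a ≤ p ∧ ¬ p ≤ a := by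
  refine ⟨fun h a ha hne => ⟨h (Or.inl ha) (Or.inr rfl) hne, h (Or.inr rfl) (Or.inl ha) hne.symm⟩,
    fun h => ?_⟩
  rintro a (ha | rfl) b (hb | rfl) hab
  · exact hA ha hb hab
  · exact (h a ha hab).1
  · exact (h b hb hab.symm).2
  · exact absurd rfl hab

theorem diff_mem_antichains {A : Set P} (hA : A ∈ antichains P) (s : Set P) :
    A \ s ∈ antichains P :=
  IsAntichain.subset hA Set.sdiff_subset

/-- Elements of `P₂` are incomparable to `x`, so they neither obstruct the toggle nor are changed by
it. -/
theorem prodPermHom_toggle_inl (e : P₁ ⊕ P₂ ≃o P) (x : P₁) :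
    prodPermHom (antichainsSumEquiv e) (toggle (antichains P₁) x, 1) =
      toggle (antichains P) (e (Sum.inl x)) := by
  refine Equiv.ext fun A => (antichainsSumEquiv e).injective ?_
  rw [apply_prodPermHom]
  have h1 := map_toggle (e' := x) (fun A => (antichainsSumEquiv e A).1) A (e := e (Sum.inl x))
    Iff.rfl (fun h => by ext y; simp [antichainsSumEquiv])
    (fun h => by
      rw [union_mem_antichains_iff (antichainsSumEquiv e A).1.2] at h
      rw [union_mem_antichains_iff A.2]
      intro a ha hne
      obtain ⟨a | a, rfl⟩ := e.surjective a
      · rw [e.le_iff_le, e.le_iff_le, Sum.inl_le_inl_iff, Sum.inl_le_inl_iff]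
        exact h a ha (fun c => hne (by rw [c]))
      · simp)
    (fun h => by ext y; simp [antichainsSumEquiv])
    (fun h => diff_mem_antichains A.2 _)
  refine Prod.ext h1 (Subtype.ext (Set.ext fun y => ?_))
  change e (Sum.inr y) ∈ A.1 ↔ e (Sum.inr y) ∈ (toggle (antichains P) (e (Sum.inl x)) A).1
  by_cases hx : e (Sum.inl x) ∈ A.1
  · rw [toggle_apply_of_diff_mem hx (diff_mem_antichains A.2 _)]
    simp
  · by_cases h : A.1 ∪ {e (Sum.inl x)} ∈ antichains P
    · rw [toggle_apply_of_union_mem hx h]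
      simp
    · rw [toggle_apply_of_union_notMem hx h]

theorem prodPermHom_toggle_inr (e : P₁ ⊕ P₂ ≃o P) (x : P₂) :
    prodPermHom (antichainsSumEquiv e) (1, toggle (antichains P₂) x) =
      toggle (antichains P) (e (Sum.inr x)) := by
  refine Equiv.ext fun A => (antichainsSumEquiv e).injective ?_
  rw [apply_prodPermHom]
  have h1 := map_toggle (e' := x) (fun A => (antichainsSumEquiv e A).2) A (e := e (Sum.inr x))
    Iff.rfl (fun h => by ext y; simp [antichainsSumEquiv])
    (fun h => by
      rw [union_mem_antichains_iff (antichainsSumEquiv e A).2.2] at h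
      rw [union_mem_antichains_iff A.2]
      intro a ha hne
      obtain ⟨a | a, rfl⟩ := e.surjective a
      · simp
      · rw [e.le_iff_le, e.le_iff_le, Sum.inr_le_inr_iff, Sum.inr_le_inr_iff]
        exact h a ha (fun c => hne (by rw [c])))
    (fun h => by ext y; simp [antichainsSumEquiv])
    (fun h => diff_mem_antichains A.2 _)
  refine Prod.ext (Subtype.ext (Set.ext fun y => ?_)) h1
  change e (Sum.inl y) ∈ A.1 ↔ e (Sum.inl y) ∈ (toggle (antichains P) (e (Sum.inr x)) A).1
  by_cases hx : e (Sum.inr x) ∈ A.1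
  · rw [toggle_apply_of_diff_mem hx (diff_mem_antichains A.2 _)]
    simp
  · by_cases h : A.1 ∪ {e (Sum.inr x)} ∈ antichains P
    · rw [toggle_apply_of_union_mem hx h]
      simp
    · rw [toggle_apply_of_union_notMem hx h]

theorem map_prodPermHom_toggleGroup (e : P₁ ⊕ P₂ ≃o P) :
    ((toggleGroup (antichains P₁)).prod (toggleGroup (antichains P₂))).map
      (prodPermHom (antichainsSumEquiv e)) = toggleGroup (antichains P) := by
  apply le_antisymm
  -- A product of subgroups is generated by its two factors, so toggles paired with `1` suffice.
  · rw [Subgroup.map_le_iff_le_comap, Subgroup.prod_le_iff, Subgroup.map_le_iff_le_comap,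
      Subgroup.map_le_iff_le_comap]
    constructor
    · refine (Subgroup.closure_le _).2 ?_
      rintro _ ⟨x, rfl⟩
      rw [SetLike.mem_coe, Subgroup.mem_comap, Subgroup.mem_comap, MonoidHom.inl_apply,
        prodPermHom_toggle_inl]
      exact toggle_mem_toggleGroup _ _
    · refine (Subgroup.closure_le _).2 ?_
      rintro _ ⟨x, rfl⟩
      rw [SetLike.mem_coe, Subgroup.mem_comap, Subgroup.mem_comap, MonoidHom.inr_apply,
        prodPermHom_toggle_inr]
      exact toggle_mem_toggleGroup _ _
  · refine (Subgroup.closure_le _).2 ?_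
    rintro _ ⟨p, rfl⟩
    obtain ⟨x | y, rfl⟩ := e.surjective p
    · exact ⟨_, ⟨toggle_mem_toggleGroup _ x, one_mem _⟩, prodPermHom_toggle_inl e x⟩
    · exact ⟨_, ⟨one_mem _, toggle_mem_toggleGroup _ y⟩, prodPermHom_toggle_inr e y⟩

/-- The toggle group of a disjoint union is the product of the toggle groups of the summands. -/
noncomputable def toggleGroupProdEquiv (e : P₁ ⊕ P₂ ≃o P) :
    toggleGroup (antichains P₁) × toggleGroup (antichains P₂) ≃* toggleGroup (antichains P) :=
  ((Subgroup.prodEquiv _ _).symm.trans (Subgroup.equivMapOfInjective _ _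
    (prodPermHom_injective (antichainsSumEquiv e)))).trans
      (MulEquiv.subgroupCongr (map_prodPermHom_toggleGroup e))

theorem toggleGroupProdEquiv_coe (e : P₁ ⊕ P₂ ≃o P)
    (g : toggleGroup (antichains P₁) × toggleGroup (antichains P₂)) :
    (toggleGroupProdEquiv e g : Perm (antichains P)) =
      prodPermHom (antichainsSumEquiv e) (g.1.1, g.2.1) := rfl

end Product

theorem mainTheorem5 {P : Type*} [PartialOrder P] [Finite P] :
    (∀ (P₁ P₂ : Type*) [PartialOrder P₁] [PartialOrder P₂] (e : P₁ ⊕ P₂ ≃o P),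
      ∃ (φ : antichains P ≃ antichains P₁ × antichains P₂)
        (Φ : toggleGroup (antichains P) ≃*
          toggleGroup (antichains P₁) × toggleGroup (antichains P₂)),
        (∀ A : antichains P,
          ((φ A).1 : Set P₁) = {x | e (Sum.inl x) ∈ (A : Set P)} ∧
          ((φ A).2 : Set P₂) = {y | e (Sum.inr y) ∈ (A : Set P)}) ∧
        ∀ (g : toggleGroup (antichains P)) (A : antichains P),
          φ ((g : Equiv.Perm (antichains P)) A) =
            (((Φ g).1 : Equiv.Perm (antichains P₁)) (φ A).1,
              ((Φ g).2 : Equiv.Perm (antichains P₂)) (φ A).2)) ∧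
    (¬ IsDisjointUnionOfPosets P → ToggleAlternating (antichains P)) := by
  refine ⟨fun P₁ P₂ _ _ e => ⟨antichainsSumEquiv e, (toggleGroupProdEquiv e).symm,
    fun A => ⟨rfl, rfl⟩, fun g A => ?_⟩, toggleAlternating_antichains⟩
  obtain ⟨g, rfl⟩ := (toggleGroupProdEquiv e).surjective g
  rw [MulEquiv.symm_apply_apply, toggleGroupProdEquiv_coe, apply_prodPermHom]
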